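/- Let $Q>0$ and $q_1>0$. A random tree evolves in continuous time from a single living node (the root). Each living node has an exponentially distributed lifetime with parameter $Q$; at the end of its life it dies and is instantly connected to $\nu\in\{0,1,2,\dots\}$ new living nodes, each of which evolves further like the root. All nodes behave independently, and lifetimes and offspring numbers are independent. Assume that $\nu$ is geometric with mean $q_1$, i.e. its generating function is $$q(z)=\mathbf E\{z^\nu\}=\frac1{1+q_1(1-z)},\qquad 0\le z\le 1 .$$ Let $\mu(t)$ be the number of all (living and dead) nodes at time $t$, and $\mu_0(t)$ the number of end-nodes at time $t$, i.e. of nodes without outgoing line (living nodes, and dead nodes with $\nu=0$). (a) For every integer $n\ge 0$ the limit $p_n=\lim_{t\to\infty}\mathcal P\{\mu(t)=n\}$ exists; $p_0=0$, and for $n\ge1$ $$p_n=\frac1{\sqrt\pi}\,\frac{\Gamma(n-1/2)}{\Gamma(n+1)}\,\frac{(4q_1)^{n-1}}{(1+q_1)^{2n-1}} .$$ For real $z\in[-1,1]$ the series $g(z)=\sum_{n\ge1}p_nz^n$ converges and $$g(z)=\frac1{2q_1}\Bigl[1+q_1-\sqrt{(1+q_1)^2-4q_1z}\,\Bigr].$$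 Moreover $\lim_{z\uparrow1}g(z)=\sum_{n\ge1}p_n$ equals $1$ if $q_1\le1$ and $1/q_1$ if $q_1>1$. (b) For every integer $n\ge 0$ the limit $p_n^{(0)}=\lim_{t\to\infty}\mathcal P\{\mu_0(t)=n\}$ exists; $p^{(0)}_0=0$. Put $$C_n=\frac{1}{2\sqrt\pi}\frac{\Gamma(n-1/2)}{\Gamma(n+1)},\quad X=\frac{q_1}{q_1+(1+q_1)(1+\sqrt{q_1})^2},\quad Y=\frac{q_1}{q_1+(1+q_1)(1-\sqrt{q_1})^2},\quad Z_n=\sum_{k=1}^{n-1}C_kC_{n-k}X^kY^{n-k}.$$ Then $$p^{(0)}_1=\frac{1}{2q_1(1+q_1)}\bigl\{q_1+(1+q_1+q_1^2)\,C_1\,(X+Y)\bigr\},\qquad p^{(0)}_n=\frac{1+q_1+q_1^2}{2q_1(1+q_1)}\bigl\{C_n(X^n+Y^n)-Z_n\bigr\}\quad(n>1).$$ For real $z\in[-1,1]$, $$\sum_{n\ge1}p^{(0)}_nz^n=\frac{1}{2q_1(1+q_1)}\Bigl[1+q_1+q_1^2+q_1z-\sqrt{(1+q_1+q_1^2+q_1z)^2-4q_1(1+q_1)^2z}\,\Bigr],$$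 and $\sum_{n\ge1}p^{(0)}_n$ equals $1$ if $q_1\le1$ and $1/q_1$ if $q_1>1$. -/

import Mathlib

open MeasureTheory ProbabilityTheory Filter Topology
open scoped ENNReal

noncomputable section

namespace EvolvingTree

/-! Nodes carry addresses `u : List ℕ`: the root is `[]` and `u ++ [k]` is the `k`-th child of `u`
(`k = 0, 1, …`). A realisation of the tree evolution is given by a lifetime `τ u` and a number
`ν u` of children for every address `u`. -/

/-- `u` is a node of the completely evolved family tree: along the path from the root to `u`,
every step leads to one of the children that are really produced. -/
def InTree (ν : List ℕ → ℕ) (u : List ℕ) : Prop :=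
  ∀ (i : ℕ) (h : i < u.length), u[i] < ν (u.take i)

/-- Birth time of the node `u`: the sum of the lifetimes of its proper ancestors. A node is born
at the instant at which its parent dies. -/
def birth (τ : List ℕ → ℝ) (u : List ℕ) : ℝ :=
  ∑ i ∈ Finset.range u.length, τ (u.take i)

/-- The nodes, living or dead, of the tree at time `t`. -/
def nodes (τ : List ℕ → ℝ) (ν : List ℕ → ℕ) (t : ℝ) : Set (List ℕ) :=
  {u | InTree ν u ∧ birth τ u ≤ t}

/-- The number of outgoing lines of `u` at time `t`: none as long as `u` lives, `ν u` from its
death on. -/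
def outDegree (τ : List ℕ → ℝ) (ν : List ℕ → ℕ) (t : ℝ) (u : List ℕ) : ℕ :=
  if birth τ u + τ u ≤ t then ν u else 0

/-- The total number `μ(t)` of nodes at time `t`. -/
def treeSize (τ : List ℕ → ℝ) (ν : List ℕ → ℕ) (t : ℝ) : ℕ∞ :=
  (nodes τ ν t).encard

/-- The number `μ(t, k)` of nodes with exactly `k` outgoing lines at time `t`. -/
def numWithOutDegree (τ : List ℕ → ℝ) (ν : List ℕ → ℕ) (t : ℝ) (k : ℕ) : ℕ∞ :=
  {u ∈ nodes τ ν t | outDegree τ ν t u = k}.encard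

/-- The number `μ₀(t) = μ(t, 0)` of end-nodes (living nodes, and dead nodes without children). -/
def numEndNodes (τ : List ℕ → ℝ) (ν : List ℕ → ℕ) (t : ℝ) : ℕ∞ :=
  numWithOutDegree τ ν t 0

/-- The randomly evolving tree: the nodes behave independently of each other and identically; the
lifetime is exponential with parameter `Q`, the number of children has law `f`, and these two are
independent. -/
structure IsRandomTree {Ω : Type*} [MeasurableSpace Ω] (P : Measure Ω) (Q : ℝ) (f : PMF ℕ)
    (τ : Ω → List ℕ → ℝ) (ν : Ω → List ℕ → ℕ) : Prop where
  indep : iIndepFun (fun (u : List ℕ) (ω : Ω) => (τ ω u, ν ω u)) P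
  law : ∀ u : List ℕ,
    HasLaw (fun ω => (τ ω u, ν ω u)) ((expMeasure Q).prod f.toMeasure) P

/-- `p` is the sequence of stationary probabilities of the counting process `X`:
`P (X t = n) → p n` as `t → ∞`, for every finite `n`. -/
def IsStationaryLaw {Ω : Type*} [MeasurableSpace Ω] (P : Measure Ω) (X : ℝ → Ω → ℕ∞)
    (p : ℕ → ℝ) : Prop :=
  ∀ n : ℕ, Tendsto (fun t : ℝ => P.real {ω | X t ω = (n : ℕ∞)}) atTop (𝓝 (p n))

/-- Generating function `∑ aₙ zⁿ` of a sequence. -/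
def genFun (a : ℕ → ℝ) (z : ℝ) : ℝ := ∑' n, a n * z ^ n

/-- `C_n = Γ(n - 1/2) / (2 √π Γ(n + 1))`. -/
def coeffC (n : ℕ) : ℝ :=
  Real.Gamma ((n : ℝ) - 1 / 2) / (2 * √Real.pi * Real.Gamma ((n : ℝ) + 1))

/-- `X(q₁)`. -/
def coeffX (q₁ : ℝ) : ℝ := q₁ / (q₁ + (1 + q₁) * (1 + √q₁) ^ 2)

/-- `Y(q₁)`. -/
def coeffY (q₁ : ℝ) : ℝ := q₁ / (q₁ + (1 + q₁) * (1 - √q₁) ^ 2)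

/-- `Z_n(q₁) = ∑_{k=1}^{n-1} C_k C_{n-k} X^k Y^{n-k}`. -/
def coeffZ (q₁ : ℝ) (n : ℕ) : ℝ :=
  ∑ k ∈ Finset.Ico 1 n, coeffC k * coeffC (n - k) * coeffX q₁ ^ k * coeffY q₁ ^ (n - k)

end EvolvingTree

end

namespace EvolvingTree

/-! Lifetimes only decide when a node appears, so as `t → ∞` the counts settle to those of the
completely evolved tree, which depends on `ν` alone. With `A = Set.univ` all nodes are counted, with
`A = {0}` the childless ones. Dominated convergence turns pathwise settling into convergence of
probabilities (`IsRandomTree.isStationaryLaw`).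

Splitting at the root gives an equation for the generating function `G` of the final count
(`finalGenFun_eq`): `G = z q(G)` for all nodes and `G = q(G) + (z - 1) q(0)` for end-nodes. For the
geometric law both are quadratics in `G`, and `G ≤ 1` selects the smaller root. Expanding the square
root gives the coefficients; nonnegativity and continuity carry the expansion to `[-1, 1]`.

One delicate point: in an infinite tree, living nodes count as end-nodes at time `t` but need not be
final ones. This is harmless because both generating functions take the same value at `1`: almost
surely, finitely many childless nodes means a finite tree (`finalCount_ne_top_ae_of_hasSum`). -/

/-- The number of nodes of the completely evolved tree whose offspring number lies in `A`. -/
noncomputable def finalCount (A : Set ℕ) (ν : List ℕ → ℕ) : ℕ∞ :=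
  {u | InTree ν u ∧ ν u ∈ A}.encard

/-- The power `z ^ n`, with `z ^ ∞ = 0`. -/
noncomputable def enatPow (z : ℝ≥0∞) (n : ℕ∞) : ℝ≥0∞ :=
  if n = ⊤ then 0 else z ^ n.toNat

@[simp] lemma enatPow_top (z : ℝ≥0∞) : enatPow z ⊤ = 0 := by simp [enatPow]

@[simp] lemma enatPow_coe (z : ℝ≥0∞) (n : ℕ) : enatPow z n = z ^ n := by simp [enatPow]

@[simp] lemma enatPow_zero (z : ℝ≥0∞) : enatPow z 0 = 1 := by simp [enatPow]

/-- The convention `z ^ ∞ = 0`, kept even at `z = 1`, preserves multiplicativity because `⊤` absorbs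
addition. At `z = 1` the expectation is then the probability that the count is finite. -/
lemma enatPow_add (z : ℝ≥0∞) (m n : ℕ∞) : enatPow z (m + n) = enatPow z m * enatPow z n := by
  induction m with
  | top => simp
  | coe m =>
    induction n with
    | top => simp
    | coe n => rw [← Nat.cast_add, enatPow_coe, enatPow_coe, enatPow_coe, pow_add]

lemma enatPow_sum {ι : Type*} (z : ℝ≥0∞) (s : Finset ι) (n : ι → ℕ∞) :
    enatPow z (∑ i ∈ s, n i) = ∏ i ∈ s, enatPow z (n i) := by
  induction s using Finset.cons_induction with
  | empty => simp
  | cons a s ha ih => rw [Finset.sum_cons, Finset.prod_cons, enatPow_add, ih]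

lemma enatPow_le_one {z : ℝ≥0∞} (hz : z ≤ 1) (n : ℕ∞) : enatPow z n ≤ 1 := by
  unfold enatPow
  split_ifs
  · exact zero_le_one
  · exact pow_le_one₀ zero_le hz

/-! ### Decomposition of the tree at the root -/

lemma inTree_nil (ν : List ℕ → ℕ) : InTree ν [] := fun i h => absurd h (by simp)

lemma inTree_cons (ν : List ℕ → ℕ) (k : ℕ) (u : List ℕ) :
    InTree ν (k :: u) ↔ k < ν [] ∧ InTree (fun v => ν (k :: v)) u := by
  constructor
  · intro h
    refine ⟨h 0 (Nat.succ_pos _), fun i hi => h (i + 1) (Nat.succ_lt_succ hi)⟩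
  · rintro ⟨h0, h⟩ i hi
    cases i with
    | zero => exact h0
    | succ i => exact h i (Nat.lt_of_succ_lt_succ hi)

lemma encard_iUnion_cons_image (S : ℕ → Set (List ℕ)) (j : ℕ) :
    (⋃ k ∈ Finset.range j, List.cons k '' S k).encard = ∑ k ∈ Finset.range j, (S k).encard := by
  induction j with
  | zero => simp
  | succ j ih =>
    rw [Finset.sum_range_succ, Finset.range_add_one, Finset.set_biUnion_insert, Set.union_comm,
      Set.encard_union_eq, ih, (List.cons_injective (a := j)).encard_image]
    rw [Set.disjoint_left]
    rintro u hu ⟨v, -, rfl⟩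
    simp only [Set.mem_iUnion] at hu
    obtain ⟨k, hk, w, -, hw⟩ := hu
    have : k = j := (List.cons.inj hw).1
    simp [this] at hk

open Classical in
lemma finalCount_eq (A : Set ℕ) (ν : List ℕ → ℕ) :
    finalCount A ν = (if ν [] ∈ A then 1 else 0) +
      ∑ k ∈ Finset.range (ν []), finalCount A (fun v => ν (k :: v)) := by
  unfold finalCount
  rw [← encard_iUnion_cons_image]
  have h : {u | InTree ν u ∧ ν u ∈ A} = (if ν [] ∈ A then {[]} else ∅) ∪
      ⋃ k ∈ Finset.range (ν []), List.cons k ''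
        {u | InTree (fun v => ν (k :: v)) u ∧ ν (k :: u) ∈ A} := by
    ext u
    cases u with
    | nil => by_cases h : ν [] ∈ A <;> simp [h, inTree_nil]
    | cons k u =>
      by_cases h : ν [] ∈ A <;> simp [h, inTree_cons, and_assoc, and_comm, and_left_comm]
  rw [h, Set.encard_union_eq]
  · congr 1
    split_ifs <;> simp
  · rw [Set.disjoint_left]
    intro u hu hu'
    split_ifs at hu
    · obtain rfl : u = [] := hu
      simp at hu'
    · exact hu

open Classical in
lemma enatPow_finalCount (A : Set ℕ) (ν : List ℕ → ℕ) (z : ℝ≥0∞) :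
    enatPow z (finalCount A ν) = (if ν [] ∈ A then z else 1) *
      ∏ k ∈ Finset.range (ν []), enatPow z (finalCount A (fun v => ν (k :: v))) := by
  rw [finalCount_eq, enatPow_add, enatPow_sum]
  congr 1
  split_ifs
  · simpa using enatPow_coe z 1
  · simp

/-- Having at least `n` elements means containing one of the countably many finsets of cardinality
`n`. -/
lemma measurable_encard {α X : Type*} [MeasurableSpace X] [Countable α] {p : X → α → Prop}
    (hp : ∀ a, MeasurableSet {x | p x a}) : Measurable fun x => {a | p x a}.encard := by
  have hle (n : ℕ) : MeasurableSet {x | (n : ℕ∞) ≤ {a | p x a}.encard} := by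
    have : {x | (n : ℕ∞) ≤ {a | p x a}.encard} =
        ⋃ (s : Finset α) (_ : s.card = n), ⋂ a ∈ s, {x | p x a} := by
      ext x
      simp only [Set.mem_ofPred_eq, Set.mem_iUnion, Set.mem_iInter, exists_prop]
      constructor
      · intro h
        obtain ⟨t, ht, htn⟩ := Set.exists_subset_encard_eq h
        have hfin : t.Finite := Set.finite_of_encard_eq_coe htn
        refine ⟨hfin.toFinset, ?_, fun a ha => ht (by simpa using ha)⟩
        rw [hfin.encard_eq_coe_toFinset_card] at htn
        exact_mod_cast htn
      · rintro ⟨s, rfl, hs⟩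
        rw [← Set.encard_coe_eq_coe_finsetCard]
        exact Set.encard_le_encard fun a ha => hs a ha
    rw [this]
    exact .iUnion fun s => .iUnion fun _ => Finset.measurableSet_biInter _ fun a _ => hp a
  refine measurable_to_countable' fun m => ?_
  induction m with
  | top =>
    have : (fun x => {a | p x a}.encard) ⁻¹' {⊤} =
        ⋂ n : ℕ, {x | (n : ℕ∞) ≤ {a | p x a}.encard} := by
      ext x
      simp only [Set.mem_preimage, Set.mem_singleton_iff, Set.mem_iInter, Set.mem_ofPred_eq]
      exact ENat.eq_top_iff_forall_ge
    rw [this]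
    exact .iInter hle
  | coe n =>
    have : (fun x => {a | p x a}.encard) ⁻¹' {(n : ℕ∞)} =
        {x | (n : ℕ∞) ≤ {a | p x a}.encard} \
          {x | ((n + 1 : ℕ) : ℕ∞) ≤ {a | p x a}.encard} := by
      ext x
      simp only [Set.mem_preimage, Set.mem_singleton_iff, Set.mem_sdiff, Set.mem_ofPred_eq, not_le]
      generalize {a | p x a}.encard = c
      induction c with
      | top => simp
      | coe c => norm_cast; omega
    rw [this]
    exact (hle n).diff (hle _)

lemma measurableSet_inTree (u : List ℕ) : MeasurableSet {ν : List ℕ → ℕ | InTree ν u} := by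
  simp only [InTree, Set.ofPred_forall]
  exact .iInter fun i => .iInter fun h => measurableSet_lt measurable_const (measurable_pi_apply _)

lemma measurable_finalCount (A : Set ℕ) : Measurable (finalCount A) :=
  measurable_encard fun u => (measurableSet_inTree u).inter
    (measurable_pi_apply u (MeasurableSet.of_discrete (s := A)))

/-! ### Generating function of the final count and its branching equation -/

/-- The generating function of the number of nodes of the completely evolved tree whose offspring
number lies in `A`, for the offspring law `μ`. -/
noncomputable def finalGenFun (μ : Measure ℕ) (A : Set ℕ) (z : ℝ≥0∞) : ℝ≥0∞ :=
  ∫⁻ ν, enatPow z (finalCount A ν) ∂Measure.infinitePi (fun _ : List ℕ => μ)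

lemma measurable_enatPow_finalCount (A : Set ℕ) (z : ℝ≥0∞) :
    Measurable fun ν => enatPow z (finalCount A ν) :=
  (Measurable.of_discrete (f := enatPow z)).comp (measurable_finalCount A)

lemma finalGenFun_le_one (μ : Measure ℕ) [IsProbabilityMeasure μ] (A : Set ℕ) {z : ℝ≥0∞}
    (hz : z ≤ 1) : finalGenFun μ A z ≤ 1 := by
  calc finalGenFun μ A z ≤ ∫⁻ _, 1 ∂Measure.infinitePi (fun _ : List ℕ => μ) :=
        lintegral_mono fun ν => enatPow_le_one hz _
    _ = 1 := by simp

/-- Builds offspring numbers from those of the root and of the subtrees of its children. -/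
def graft (y : Option ℕ → List ℕ → ℕ) : List ℕ → ℕ
  | [] => y none []
  | k :: u => y (some k) u

/-- The index at which `graft` reads the offspring number of a node. -/
def graftIndex : List ℕ → Option ℕ × List ℕ
  | [] => (none, [])
  | k :: u => (some k, u)

lemma graftIndex_injective : Function.Injective graftIndex := by
  rintro (_ | ⟨k, u⟩) (_ | ⟨l, v⟩) h <;> simp_all [graftIndex]

/-- Reading an i.i.d. family along an injection of indices gives an i.i.d. family. The copy at
`none` serves only for its root entry; the copy at `some k` is the whole subtree of child `k`. -/
lemma map_graft (μ : Measure ℕ) [IsProbabilityMeasure μ] :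
    (Measure.infinitePi fun _ : Option ℕ => Measure.infinitePi fun _ : List ℕ => μ).map graft =
      Measure.infinitePi fun _ : List ℕ => μ := by
  have h := Measure.map_infinitePi_infinitePi_of_inj (P := fun _ : Option ℕ × List ℕ => μ)
    graftIndex_injective
  have h' := Measure.infinitePi_map_curry_symm fun (_ : Option ℕ) (_ : List ℕ) => μ
  rw [← h', Measure.map_map (by fun_prop) (by fun_prop)] at h
  refine Eq.trans ?_ h
  congr 1
  funext y u
  cases u <;> rfl

lemma measurable_graft : Measurable graft := by
  refine measurable_pi_iff.2 fun u => ?_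
  cases u with
  | nil => exact (measurable_pi_apply []).comp (measurable_pi_apply none)
  | cons k u => exact (measurable_pi_apply u).comp (measurable_pi_apply (some k))

open Classical in
lemma finalGenFun_eq (μ : Measure ℕ) [IsProbabilityMeasure μ] (A : Set ℕ) (z : ℝ≥0∞) :
    finalGenFun μ A z = ∑' j, μ {j} * (if j ∈ A then z else 1) * finalGenFun μ A z ^ j := by
  set M := Measure.infinitePi fun _ : Option ℕ => Measure.infinitePi fun _ : List ℕ => μ with hM
  -- Fixing the root's offspring number `j` by an indicator makes the number of factors
  -- deterministic. Each factor then reads a different coordinate of `y`, so independence applies.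
  have hsplit (y : Option ℕ → List ℕ → ℕ) : enatPow z (finalCount A (graft y)) =
      ∑' j, (if j ∈ A then z else 1) * ∏ i ∈ Finset.insertNone (Finset.range j),
        (Option.elim i (fun x : List ℕ → ℕ => if x [] = j then 1 else 0)
          (fun _ x => enatPow z (finalCount A x)) : (List ℕ → ℕ) → ℝ≥0∞) (y i) := by
    rw [tsum_eq_single (y none []), enatPow_finalCount]
    · rw [Finset.prod_insertNone]
      simp only [graft, Option.elim_none, Option.elim_some, if_true, one_mul]
      rfl
    · intro j hj
      simp [hj.symm]
  have hmeas (j : ℕ) (i : Option ℕ) : Measurable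
      (Option.elim i (fun x : List ℕ → ℕ => if x [] = j then 1 else 0)
        (fun _ x => enatPow z (finalCount A x)) : (List ℕ → ℕ) → ℝ≥0∞) := by
    cases i with
    | none =>
      exact (Measurable.of_discrete (f := fun m : ℕ => if m = j then (1 : ℝ≥0∞) else 0)).comp
        (measurable_pi_apply [])
    | some k => exact measurable_enatPow_finalCount A z
  have heval (i : Option ℕ) (F : (List ℕ → ℕ) → ℝ≥0∞) (hF : Measurable F) :
      ∫⁻ y, F (y i) ∂M = ∫⁻ x, F x ∂Measure.infinitePi (fun _ : List ℕ => μ) := by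
    rw [← Measure.infinitePi_map_eval (fun _ : Option ℕ => Measure.infinitePi
      fun _ : List ℕ => μ) i, lintegral_map hF (measurable_pi_apply i)]
  conv_lhs => rw [finalGenFun, ← map_graft,
    lintegral_map (measurable_enatPow_finalCount A z) measurable_graft]
  simp_rw [hsplit]
  have hprod (j : ℕ) : Measurable fun y : Option ℕ → List ℕ → ℕ =>
      ∏ i ∈ Finset.insertNone (Finset.range j),
        (Option.elim i (fun x : List ℕ → ℕ => if x [] = j then 1 else 0)
          (fun _ x => enatPow z (finalCount A x)) : (List ℕ → ℕ) → ℝ≥0∞) (y i) :=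
    Finset.measurable_fun_prod _ fun i _ => (hmeas j i).comp (measurable_pi_apply i)
  rw [lintegral_tsum fun j => ((hprod j).const_mul _).aemeasurable]
  refine tsum_congr fun j => ?_
  rw [lintegral_const_mul _ (hprod j),
    lintegral_prod_eq_prod_lintegral_of_indepFun _ _ (iIndepFun_infinitePi (hmeas j))
      fun i => (hmeas j i).comp (measurable_pi_apply i)]
  rw [Finset.prod_congr rfl fun i _ => heval i _ (hmeas j i), Finset.prod_insertNone]
  simp only [Option.elim_none, Option.elim_some, Finset.prod_const, Finset.card_range]
  have h0 : ∫⁻ x : List ℕ → ℕ, (if x [] = j then 1 else 0)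
      ∂Measure.infinitePi (fun _ : List ℕ => μ) = μ {j} := by
    rw [← lintegral_map (f := fun m : ℕ => if m = j then (1 : ℝ≥0∞) else 0)
      .of_discrete (measurable_pi_apply []), Measure.infinitePi_map_eval]
    have : (fun m : ℕ => if m = j then (1 : ℝ≥0∞) else 0) = Set.indicator {j} 1 := by
      ext m; simp [Set.indicator_apply]
    rw [this, lintegral_indicator_one (measurableSet_singleton j)]
  rw [h0, finalGenFun]
  ring

lemma finalGenFun_eq_tsum (μ : Measure ℕ) (A : Set ℕ) (z : ℝ≥0∞) :
    finalGenFun μ A z = ∑' n : ℕ,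
      Measure.infinitePi (fun _ : List ℕ => μ) {ν | finalCount A ν = n} * z ^ n := by
  have h (ν : List ℕ → ℕ) : enatPow z (finalCount A ν) =
      ∑' n : ℕ, Set.indicator {ν | finalCount A ν = n} (fun _ => z ^ n) ν := by
    by_cases ht : finalCount A ν = ⊤
    · simp [ht]
    · obtain ⟨m, hm⟩ := ENat.ne_top_iff_exists.1 ht
      rw [tsum_eq_single m, ← hm]
      · simp [← hm]
      · intro n hn
        simp [← hm, hn.symm]
  have hms (n : ℕ) : MeasurableSet {ν | finalCount A ν = n} :=
    measurable_finalCount A (MeasurableSet.of_discrete (s := {(n : ℕ∞)}))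
  unfold finalGenFun
  simp_rw [h]
  rw [lintegral_tsum fun n => (measurable_const.indicator (hms n)).aemeasurable]
  refine tsum_congr fun n => ?_
  rw [lintegral_indicator_const (hms n), mul_comm]

end EvolvingTree
namespace EvolvingTree

/-! ### Convergence of the counts as time tends to infinity -/

/-- The probability that the completely evolved tree has exactly `n` nodes with offspring number
in `A`. -/
noncomputable def finalProb (μ : Measure ℕ) (A : Set ℕ) (n : ℕ) : ℝ :=
  (Measure.infinitePi fun _ : List ℕ => μ).real {ν | finalCount A ν = n}

lemma finalProb_nonneg (μ : Measure ℕ) (A : Set ℕ) (n : ℕ) : 0 ≤ finalProb μ A n :=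
  measureReal_nonneg

lemma measurableSet_finalCount_eq (A : Set ℕ) (n : ℕ∞) : MeasurableSet {ν | finalCount A ν = n} :=
  measurable_finalCount A (MeasurableSet.of_discrete (s := {n}))

lemma hasSum_finalProb (μ : Measure ℕ) [IsProbabilityMeasure μ] (A : Set ℕ) {z : ℝ}
    (hz : z ∈ Set.Icc (0 : ℝ) 1) :
    HasSum (fun n => finalProb μ A n * z ^ n) (finalGenFun μ A (ENNReal.ofReal z)).toReal := by
  have hle : finalGenFun μ A (ENNReal.ofReal z) ≤ 1 :=
    finalGenFun_le_one μ A (ENNReal.ofReal_le_one.2 hz.2)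
  rw [finalGenFun_eq_tsum] at hle ⊢
  have h := ENNReal.hasSum_toReal (hle.trans_lt ENNReal.one_lt_top).ne
  rw [← ENNReal.tsum_toReal_eq (ENNReal.ne_top_of_tsum_ne_top
    (hle.trans_lt ENNReal.one_lt_top).ne)] at h
  convert! h using 2 with n
  rw [ENNReal.toReal_mul, ENNReal.toReal_pow, ENNReal.toReal_ofReal hz.1]
  rfl

open Classical in
lemma hasSum_finalGenFun (f : PMF ℕ) (A : Set ℕ) {z : ℝ} (hz : z ∈ Set.Icc (0 : ℝ) 1) :
    HasSum (fun j => (f j).toReal * (if j ∈ A then z else 1) *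
      (finalGenFun f.toMeasure A (ENNReal.ofReal z)).toReal ^ j)
      (finalGenFun f.toMeasure A (ENNReal.ofReal z)).toReal := by
  have hle : finalGenFun f.toMeasure A (ENNReal.ofReal z) ≤ 1 :=
    finalGenFun_le_one _ A (ENNReal.ofReal_le_one.2 hz.2)
  have hne := (hle.trans_lt ENNReal.one_lt_top).ne
  have he := finalGenFun_eq f.toMeasure A (ENNReal.ofReal z)
  have hs := he ▸ hne
  have h := ENNReal.hasSum_toReal hs
  rw [← ENNReal.tsum_toReal_eq (ENNReal.ne_top_of_tsum_ne_top hs), ← he] at h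
  convert! h using 2 with j
  rw [ENNReal.toReal_mul, ENNReal.toReal_mul, ENNReal.toReal_pow,
    PMF.toMeasure_apply_singleton _ _ (measurableSet_singleton j)]
  split_ifs <;> simp [ENNReal.toReal_ofReal hz.1]

/-- A finite `B`-count forces a finite `A`-count; since both events have probability `s`, they agree
almost everywhere. -/
lemma finalCount_ne_top_ae_of_hasSum (μ : Measure ℕ) [IsProbabilityMeasure μ] {A B : Set ℕ}
    {s : ℝ} (hAB : A ⊆ B) (hA : HasSum (finalProb μ A) s) (hB : HasSum (finalProb μ B) s) :
    ∀ᵐ ν ∂Measure.infinitePi (fun _ : List ℕ => μ),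
      finalCount A ν ≠ ⊤ → finalCount B ν ≠ ⊤ := by
  set M := Measure.infinitePi fun _ : List ℕ => μ with hM
  have hfin (C : Set ℕ) (hC : HasSum (finalProb μ C) s) :
      M {ν | finalCount C ν ≠ ⊤} = ENNReal.ofReal s := by
    have hU : {ν | finalCount C ν ≠ ⊤} = ⋃ n : ℕ, {ν | finalCount C ν = n} := by
      ext ν
      simp only [Set.mem_ofPred_eq, Set.mem_iUnion]
      rw [ENat.ne_top_iff_exists]
      simp only [eq_comm]
    rw [hU, measure_iUnion ?_ fun n : ℕ => measurableSet_finalCount_eq C n, ← hC.tsum_eq,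
      ENNReal.ofReal_tsum_of_nonneg (finalProb_nonneg μ C) hC.summable]
    · exact tsum_congr fun n => (ofReal_measureReal).symm
    · intro m n hmn
      refine Set.disjoint_left.2 fun ν (h1 : _ = _) (h2 : _ = _) => hmn ?_
      exact_mod_cast h1.symm.trans h2
  have hsub : {ν | finalCount B ν ≠ ⊤} ⊆ {ν | finalCount A ν ≠ ⊤} := fun ν hν h =>
    hν (top_le_iff.1 (h ▸ Set.encard_le_encard fun u hu => ⟨hu.1, hAB hu.2⟩))
  have hms : MeasurableSet {ν | finalCount B ν ≠ ⊤} := (measurableSet_finalCount_eq B ⊤).compl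
  have hae := ae_eq_of_subset_of_measure_ge hsub (by rw [hfin A hA, hfin B hB])
    hms.nullMeasurableSet (measure_ne_top M _)
  filter_upwards [hae] with ν hν h
  exact (Iff.of_eq hν).2 h

lemma eventually_encard_eq_iff {α : Type*} {S : ℝ → Set α} {T : Set α}
    (h1 : ∀ a ∈ T, ∀ᶠ t in atTop, a ∈ S t) (h2 : T.Finite → ∀ᶠ t in atTop, S t ⊆ T) (n : ℕ) :
    ∀ᶠ t in atTop, (S t).encard = n ↔ T.encard = n := by
  by_cases hT : T.Finite
  · filter_upwards [h2 hT, (eventually_all_finite hT).2 h1] with t ht ht'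
    rw [Set.Subset.antisymm ht ht']
  · have hT' : T.encard = ⊤ := Set.encard_eq_top_iff.2 hT
    -- For infinite `T`, some `n + 1` of its elements eventually lie in `S t`, so both sides of the
    -- equivalence are false.
    obtain ⟨U, hU, hUn⟩ := Set.exists_subset_encard_eq (s := T) (k := ((n + 1 : ℕ) : ℕ∞))
      (hT' ▸ le_top)
    filter_upwards [(eventually_all_finite (Set.finite_of_encard_eq_coe hUn)).2
      fun a ha => h1 a (hU ha)] with t ht
    have hle : U.encard ≤ (S t).encard := Set.encard_le_encard ht
    rw [hUn] at hle
    refine iff_of_false (fun h => ?_) (by simp [hT'])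
    rw [h] at hle
    norm_cast at hle
    omega

lemma eventually_treeSize_eq_iff (τ : List ℕ → ℝ) (ν : List ℕ → ℕ) (n : ℕ) :
    ∀ᶠ t in atTop, treeSize τ ν t = n ↔ finalCount Set.univ ν = n := by
  refine eventually_encard_eq_iff (fun u hu => ?_) (fun _ => .of_forall fun t u hu => ?_) n
  · filter_upwards [eventually_ge_atTop (birth τ u)] with t ht
    exact ⟨hu.1, ht⟩
  · exact ⟨hu.1, trivial⟩

lemma eventually_numEndNodes_eq_iff (τ : List ℕ → ℝ) (ν : List ℕ → ℕ)
    (hν : finalCount {0} ν ≠ ⊤ → finalCount Set.univ ν ≠ ⊤) (n : ℕ) :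
    ∀ᶠ t in atTop, numEndNodes τ ν t = n ↔ finalCount {0} ν = n := by
  refine eventually_encard_eq_iff (fun u hu => ?_) (fun hfin => ?_) n
  · filter_upwards [eventually_ge_atTop (birth τ u)] with t ht
    refine ⟨⟨hu.1, ht⟩, ?_⟩
    unfold outDegree
    split_ifs
    · exact hu.2
    · rfl
  · have hT : {u | InTree ν u ∧ ν u ∈ Set.univ}.Finite :=
      Set.encard_ne_top_iff.1 (hν (Set.encard_ne_top_iff.2 hfin))
    -- A finite tree is eventually entirely dead, after which every end-node is truly childless.
    filter_upwards [(eventually_all_finite hT).2 fun u _ =>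
      eventually_ge_atTop (birth τ u + τ u)] with t ht u hu
    have h0 := hu.2
    rw [outDegree, if_pos (ht u ⟨hu.1.1, trivial⟩)] at h0
    exact ⟨hu.1.1, h0⟩

lemma measurable_birth (u : List ℕ) : Measurable fun τ : List ℕ → ℝ => birth τ u := by
  unfold birth
  fun_prop

lemma measurableSet_mem_nodes (t : ℝ) (u : List ℕ) :
    MeasurableSet {x : (List ℕ → ℝ) × (List ℕ → ℕ) | u ∈ nodes x.1 x.2 t} :=
  (measurable_snd (measurableSet_inTree u)).inter
    (measurableSet_le ((measurable_birth u).comp measurable_fst) measurable_const)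

lemma measurable_treeSize (t : ℝ) :
    Measurable fun x : (List ℕ → ℝ) × (List ℕ → ℕ) => treeSize x.1 x.2 t :=
  measurable_encard fun u => measurableSet_mem_nodes t u

lemma measurable_outDegree (t : ℝ) (u : List ℕ) :
    Measurable fun x : (List ℕ → ℝ) × (List ℕ → ℕ) => outDegree x.1 x.2 t u := by
  unfold outDegree
  refine Measurable.ite (measurableSet_le ?_ measurable_const) (by fun_prop) measurable_const
  exact ((measurable_birth u).comp measurable_fst).add (by fun_prop)

lemma measurable_numEndNodes (t : ℝ) :
    Measurable fun x : (List ℕ → ℝ) × (List ℕ → ℕ) => numEndNodes x.1 x.2 t :=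
  measurable_encard fun u => (measurableSet_mem_nodes t u).inter
    (measurable_outDegree t u (measurableSet_singleton 0))

section Limit

variable {Ω : Type*} [MeasurableSpace Ω] {P : Measure Ω} {Q : ℝ}
  {f : PMF ℕ} {τ : Ω → List ℕ → ℝ} {ν : Ω → List ℕ → ℕ}

lemma IsRandomTree.hasLaw_offspring (hQ : 0 < Q) (h : IsRandomTree P Q f τ ν) :
    HasLaw ν (Measure.infinitePi fun _ : List ℕ => f.toMeasure) P := by
  have := isProbabilityMeasure_expMeasure hQ
  refine iIndepFun.hasLaw_infinitePi (X := fun u ω => ν ω u) (fun u => ?_)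
    (h.indep.comp (fun _ => Prod.snd) fun _ => measurable_snd) ?_
  · exact (measurePreserving_snd (μ := expMeasure Q) (ν := f.toMeasure)).hasLaw.comp (h.law u)
  · exact aemeasurable_pi_iff.2 fun u => measurable_snd.comp_aemeasurable (h.law u).aemeasurable

lemma IsRandomTree.isStationaryLaw [IsProbabilityMeasure P] (hQ : 0 < Q) (h : IsRandomTree P Q f τ ν) {A : Set ℕ}
    {X : (List ℕ → ℝ) → (List ℕ → ℕ) → ℝ → ℕ∞}
    (hX : ∀ t, Measurable fun x : (List ℕ → ℝ) × (List ℕ → ℕ) => X x.1 x.2 t)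
    (hlim : ∀ᵐ ν ∂Measure.infinitePi (fun _ : List ℕ => f.toMeasure), ∀ τ (n : ℕ),
      ∀ᶠ t in atTop, X τ ν t = n ↔ finalCount A ν = n) :
    IsStationaryLaw P (fun t ω => X (τ ω) (ν ω) t) (finalProb f.toMeasure A) := by
  intro n
  have hν := h.hasLaw_offspring hQ
  have hτ : AEMeasurable τ P := aemeasurable_pi_iff.2 fun u =>
    measurable_fst.comp_aemeasurable (h.law u).aemeasurable
  have hΦ : AEMeasurable (fun ω => (τ ω, ν ω)) P := hτ.prodMk hν.aemeasurable
  set P' := P.map fun ω => (τ ω, ν ω) with hP'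
  have : IsProbabilityMeasure P' := Measure.isProbabilityMeasure_map hΦ
  have hms (t : ℝ) : MeasurableSet {x : (List ℕ → ℝ) × (List ℕ → ℕ) | X x.1 x.2 t = n} :=
    hX t (MeasurableSet.of_discrete (s := {(n : ℕ∞)}))
  have hmsA : MeasurableSet {x : (List ℕ → ℝ) × (List ℕ → ℕ) | finalCount A x.2 = n} :=
    measurable_snd (measurableSet_finalCount_eq A n)
  have hsnd : P'.map Prod.snd = Measure.infinitePi fun _ : List ℕ => f.toMeasure := by
    rw [hP', AEMeasurable.map_map_of_aemeasurable measurable_snd.aemeasurable hΦ]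
    exact hν.map_eq
  have hae : ∀ᵐ x ∂P', ∀ᶠ t in atTop, X x.1 x.2 t = n ↔ finalCount A x.2 = n := by
    rw [← hsnd] at hlim
    filter_upwards [ae_of_ae_map measurable_snd.aemeasurable hlim] with x hx
    exact hx x.1 n
  have hlim' := tendsto_measure_of_ae_tendsto_indicator_of_isFiniteMeasure atTop hmsA hms hae
  have hval : P' {x | finalCount A x.2 = n} =
      Measure.infinitePi (fun _ : List ℕ => f.toMeasure) {ν | finalCount A ν = n} := by
    rw [← hsnd, Measure.map_apply measurable_snd (measurableSet_finalCount_eq A n)]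
    rfl
  rw [hval] at hlim'
  refine ((ENNReal.tendsto_toReal (measure_ne_top _ _)).comp hlim').congr fun t => ?_
  rw [Function.comp_apply, hP', Measure.map_apply_of_aemeasurable hΦ (hms t)]
  rfl

end Limit

end EvolvingTree
namespace EvolvingTree

/-! ### Power series: the square root, uniqueness of coefficients, boundary values -/

lemma coeffC_zero : coeffC 0 = -1 := by
  have h := Real.Gamma_add_one (s := -1 / 2) (by norm_num)
  norm_num [Real.Gamma_one_half_eq] at h
  have hpi : √Real.pi ≠ 0 := (Real.sqrt_pos.2 Real.pi_pos).ne'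
  have h' : Real.Gamma (-1 / 2) = -2 * √Real.pi := by linarith
  rw [coeffC]
  rw [Nat.cast_zero, zero_sub, ← neg_div, h', zero_add, Real.Gamma_one, mul_one]
  field_simp

lemma coeffC_succ (n : ℕ) : coeffC (n + 1) = ((n : ℝ) - 1 / 2) / (n + 1) * coeffC n := by
  have h0 : (n : ℝ) - 1 / 2 ≠ 0 := by
    intro h
    have h2 : (2 * n : ℝ) = 1 := by linarith
    norm_cast at h2
    omega
  have h1 : Real.Gamma ((n : ℝ) + 1) ≠ 0 := (Real.Gamma_pos_of_pos (by positivity)).ne'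
  have hpi : √Real.pi ≠ 0 := (Real.sqrt_pos.2 Real.pi_pos).ne'
  have e1 : Real.Gamma (((n + 1 : ℕ) : ℝ) - 1 / 2) = (n - 1 / 2) * Real.Gamma (n - 1 / 2) := by
    rw [← Real.Gamma_add_one h0]; congr 1; push_cast; ring
  have e2 : Real.Gamma (((n + 1 : ℕ) : ℝ) + 1) = (n + 1) * Real.Gamma (n + 1) := by
    rw [← Real.Gamma_add_one (by positivity)]; push_cast; rfl
  rw [coeffC, coeffC, e1, e2]
  field_simp

lemma choose_half_mul_neg_one_pow (n : ℕ) :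
    Ring.choose (1 / 2 : ℝ) n * (-1) ^ n = -coeffC n := by
  induction n with
  | zero => simp [coeffC_zero]
  | succ n ih =>
    have h : ((n : ℝ) + 1) * Ring.choose (1 / 2 : ℝ) (n + 1) =
        (1 / 2 - n) * Ring.choose (1 / 2 : ℝ) n := by
      have hf : ((n.factorial : ℕ) : ℝ) ≠ 0 := by positivity
      simp only [Ring.choose_eq_smul, descPochhammer_succ_right, Polynomial.smeval_mul,
        Nat.factorial_succ, smul_eq_mul]
      simp only [Polynomial.smeval_sub, Polynomial.smeval_X, Polynomial.smeval_natCast]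
      push_cast
      field_simp
      simp [mul_comm]
    rw [coeffC_succ, pow_succ]
    have h' : Ring.choose (1 / 2 : ℝ) (n + 1) =
        (1 / 2 - n) / (n + 1) * Ring.choose (1 / 2 : ℝ) n := by
      field_simp
      linarith
    rw [h']
    linear_combination ((n : ℝ) - 1 / 2) / (n + 1) * ih

/-- The binomial expansion of `√(1 - w)`. -/
lemma hasSum_sqrt_one_sub {w : ℝ} (hw : |w| < 1) :
    HasSum (fun n => -coeffC n * w ^ n) √(1 - w) := by
  have h := (Real.one_add_rpow_hasFPowerSeriesOnBall_zero (a := 1 / 2)).hasSum (y := -w)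
    (by simpa [Metric.mem_eball, edist_dist, Real.dist_eq] using hw)
  rw [Real.sqrt_eq_rpow]
  convert! h using 1
  · funext n
    rw [binomialSeries_apply, ← choose_half_mul_neg_one_pow]
    simp only [List.ofFn_const, List.prod_replicate, smul_eq_mul]
    rw [neg_pow w]
    ring
  · simp [sub_eq_add_neg]

/-- A real power series vanishing on `[0, 1)` has zero coefficients. -/
lemma coeff_eq_zero_of_hasSum_zero {c : ℕ → ℝ}
    (h : ∀ z ∈ Set.Ico (0 : ℝ) 1, HasSum (fun n => c n * z ^ n) 0) (n : ℕ) : c n = 0 := by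
  set p := FormalMultilinearSeries.ofScalars ℝ c with hp
  have hrad : ((1 / 2 : NNReal) : ℝ≥0∞) ≤ p.radius := by
    apply p.le_radius_of_summable_norm
    have := (h (1 / 2) (by norm_num)).summable.abs
    refine this.congr fun n => ?_
    rw [hp, FormalMultilinearSeries.ofScalars_norm, abs_mul]
    simp
  have hpos : 0 < p.radius := lt_of_lt_of_le (by norm_num) hrad
  have hat : HasFPowerSeriesAt p.sum p 0 := (p.hasFPowerSeriesOnBall hpos).hasFPowerSeriesAt
  have hsum (z : ℝ) (hz : z ∈ Set.Ico (0 : ℝ) 1) : p.sum z = 0 := by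
    rw [← (h z hz).tsum_eq, FormalMultilinearSeries.sum]
    refine tsum_congr fun n => ?_
    simp [hp, mul_comm]
  -- Zeros to the right of `0` already accumulate there, so the analytic sum vanishes near `0`.
  have hfreq : ∃ᶠ z in 𝓝[≠] (0 : ℝ), p.sum z = 0 := by
    have : ∃ᶠ z in 𝓝[>] (0 : ℝ), p.sum z = 0 := by
      refine Eventually.frequently ?_
      filter_upwards [Ioo_mem_nhdsGT (zero_lt_one (α := ℝ))] with z hz
      exact hsum z ⟨hz.1.le, hz.2⟩
    exact this.filter_mono (nhdsGT_le_nhdsNE 0)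
  have hz := hat.analyticAt.frequently_zero_iff_eventually_zero.1 hfreq
  have hp0 : p = 0 := hat.locally_zero_iff.1 hz
  rw [← FormalMultilinearSeries.coeff_ofScalars (𝕜 := ℝ) (p := c) (n := n), ← hp, hp0]
  rfl

lemma coeff_eq_of_hasSum {a b : ℕ → ℝ} {F : ℝ → ℝ}
    (ha : ∀ z ∈ Set.Ico (0 : ℝ) 1, HasSum (fun n => a n * z ^ n) (F z))
    (hb : ∀ z ∈ Set.Ico (0 : ℝ) 1, HasSum (fun n => b n * z ^ n) (F z)) : a = b := by
  funext n
  refine sub_eq_zero.1 (coeff_eq_zero_of_hasSum_zero (c := fun n => a n - b n) (fun z hz => ?_) n)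
  simpa [sub_mul] using (ha z hz).sub (hb z hz)

/-- A power series with nonnegative coefficients whose sum extends continuously to `[-1, 1]`
converges to the extension on `[-1, 1]`. -/
lemma hasSum_of_continuousOn_Icc {a : ℕ → ℝ} {F : ℝ → ℝ} (ha : ∀ n, 0 ≤ a n)
    (h : ∀ z, |z| < 1 → HasSum (fun n => a n * z ^ n) (F z))
    (hF : ContinuousOn F (Set.Icc (-1) 1)) {z : ℝ} (hz : z ∈ Set.Icc (-1 : ℝ) 1) :
    HasSum (fun n => a n * z ^ n) (F z) := by
  have hsum : Summable a := by
    -- Each partial sum is at most `F z` for `z` in `(0, 1)`; letting `z` increase to `1` bounds it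
    -- by `F 1`.
    refine summable_of_sum_range_le (c := F 1) ha fun N => ?_
    have h1 : Tendsto (fun z : ℝ => ∑ n ∈ Finset.range N, a n * z ^ n) (𝓝[<] 1)
        (𝓝 (∑ n ∈ Finset.range N, a n * 1 ^ n)) := by
      refine Tendsto.mono_left (Continuous.tendsto ?_ 1) nhdsWithin_le_nhds
      fun_prop
    have h2 : Tendsto F (𝓝[<] 1) (𝓝 (F 1)) :=
      (hF 1 (by norm_num)).mono_left (by
        rw [← nhdsWithin_Ioo_eq_nhdsLT (show (-1 : ℝ) < 1 by norm_num)]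
        exact nhdsWithin_mono _ Set.Ioo_subset_Icc_self)
    have := le_of_tendsto_of_tendsto h1 h2 (by
      filter_upwards [Ioo_mem_nhdsLT (show (0 : ℝ) < 1 by norm_num)] with z hz
      exact sum_le_hasSum _ (fun n _ => mul_nonneg (ha n) (pow_nonneg hz.1.le n))
        (h z (by rw [abs_of_pos hz.1]; exact hz.2)))
    simpa using this
  have hle (n : ℕ) (z : ℝ) (hz : z ∈ Set.Icc (-1 : ℝ) 1) : ‖a n * z ^ n‖ ≤ a n := by
    rw [norm_mul, norm_pow, Real.norm_of_nonneg (ha n)]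
    exact mul_le_of_le_one_right (ha n) (pow_le_one₀ (norm_nonneg z) (abs_le.2 hz))
  have hcont : ContinuousOn (fun z => ∑' n, a n * z ^ n) (Set.Icc (-1 : ℝ) 1) :=
    continuousOn_tsum (fun n => by fun_prop) hsum hle
  have heq : Set.EqOn (fun z => ∑' n, a n * z ^ n) F (Set.Icc (-1 : ℝ) 1) := by
    refine Set.EqOn.of_subset_closure (s := Set.Ioo (-1 : ℝ) 1) (fun z hz => ?_) hcont hF
      Set.Ioo_subset_Icc_self ?_
    · exact (h z (abs_lt.2 hz)).tsum_eq
    · rw [closure_Ioo (by norm_num)]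
  rw [← heq hz]
  exact (Summable.of_norm_bounded hsum fun n => hle n z hz).hasSum

/-- The smaller root of a convex quadratic is the only one in `(-∞, 1]` if the quadratic is
negative at `1`. -/
lemma eq_smaller_root {α β γ x : ℝ} (hα : 0 < α) (hx : x ≤ 1) (h1 : α - β + γ < 0)
    (h : α * x ^ 2 - β * x + γ = 0) : x = (β - √(β ^ 2 - 4 * α * γ)) / (2 * α) := by
  have hx1 : x < 1 := lt_of_le_of_ne hx (by rintro rfl; linarith)
  -- Subtracting the value at `1` from that at `x` gives `(1 - x) * (β - α * (1 + x)) > 0`.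
  have h2 : α * (1 + x) < β := by
    by_contra hc
    nlinarith [mul_nonneg (sub_nonneg.2 hx) (sub_nonneg.2 (not_lt.1 hc))]
  have h3 : 0 ≤ β - 2 * α * x := by nlinarith
  have h4 : β ^ 2 - 4 * α * γ = (β - 2 * α * x) ^ 2 := by linear_combination (-4 * α) * h
  rw [h4, Real.sqrt_sq h3]
  field_simp
  ring

end EvolvingTree
namespace EvolvingTree

/-! ### The two explicit generating functions and their coefficients -/

/-- The generating function of the final number of nodes. -/
noncomputable def sizeGenFun (q z : ℝ) : ℝ :=
  1 / (2 * q) * (1 + q - √((1 + q) ^ 2 - 4 * q * z))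

/-- The generating function of the final number of end-nodes. -/
noncomputable def endGenFun (q z : ℝ) : ℝ :=
  1 / (2 * q * (1 + q)) * (1 + q + q ^ 2 + q * z -
    √((1 + q + q ^ 2 + q * z) ^ 2 - 4 * q * (1 + q) ^ 2 * z))

lemma continuous_sizeGenFun (q : ℝ) : Continuous (sizeGenFun q) := by
  unfold sizeGenFun
  fun_prop

lemma continuous_endGenFun (q : ℝ) : Continuous (endGenFun q) := by
  unfold endGenFun
  fun_prop

lemma sizeGenFun_one {q : ℝ} (hq : 0 < q) :
    sizeGenFun q 1 = if q ≤ 1 then 1 else 1 / q := by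
  have h : (1 + q) ^ 2 - 4 * q * 1 = (1 - q) ^ 2 := by ring
  rw [sizeGenFun, h, Real.sqrt_sq_eq_abs]
  split_ifs with h1
  · rw [abs_of_nonneg (by linarith)]
    field_simp
    ring
  · rw [abs_of_neg (by linarith)]
    field_simp
    ring

lemma endGenFun_one {q : ℝ} (hq : 0 < q) :
    endGenFun q 1 = if q ≤ 1 then 1 else 1 / q := by
  have h : (1 + q + q ^ 2 + q * 1) ^ 2 - 4 * q * (1 + q) ^ 2 * 1 = ((1 + q) * (1 - q)) ^ 2 := by
    ring
  rw [endGenFun, h, Real.sqrt_sq_eq_abs, abs_mul, abs_of_pos (show 0 < 1 + q by linarith)]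
  split_ifs with h1
  · rw [abs_of_nonneg (by linarith)]
    field_simp
    ring
  · rw [abs_of_neg (by linarith)]
    field_simp
    ring

/-- The coefficients of `sizeGenFun q`. -/
noncomputable def sizeCoeff (q : ℝ) (n : ℕ) : ℝ :=
  1 / (2 * q) * ((if n = 0 then 1 + q else 0) + (1 + q) * (coeffC n * (4 * q / (1 + q) ^ 2) ^ n))

lemma hasSum_ite_eq_mul_pow (m : ℕ) (a z : ℝ) :
    HasSum (fun n => (if n = m then a else 0) * z ^ n) (a * z ^ m) := by
  convert! hasSum_ite_eq m (a * z ^ m) using 2 with n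
  split_ifs with h <;> simp [h]

lemma hasSum_sizeCoeff {q : ℝ} (hq : 0 < q) {z : ℝ} (hz : |z| < 1) :
    HasSum (fun n => sizeCoeff q n * z ^ n) (sizeGenFun q z) := by
  have hw1 : 4 * q / (1 + q) ^ 2 ≤ 1 := by
    rw [div_le_one (by positivity)]
    nlinarith [sq_nonneg (1 - q)]
  have hw : |4 * q / (1 + q) ^ 2 * z| < 1 := by
    rw [abs_mul, abs_of_nonneg (by positivity)]
    nlinarith [abs_nonneg z]
  have hsq : (1 + q) * √(1 - 4 * q / (1 + q) ^ 2 * z) = √((1 + q) ^ 2 - 4 * q * z) := by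
    rw [show (1 + q) ^ 2 - 4 * q * z = (1 + q) ^ 2 * (1 - 4 * q / (1 + q) ^ 2 * z) by field_simp,
      Real.sqrt_mul (by positivity), Real.sqrt_sq (by positivity)]
  have h := ((hasSum_ite_eq_mul_pow 0 (1 + q) z).sub
    ((hasSum_sqrt_one_sub hw).mul_left (1 + q))).mul_left (1 / (2 * q))
  rw [hsq, pow_zero, mul_one] at h
  rw [sizeGenFun]
  convert! h using 2 with n
  rw [sizeCoeff, mul_pow]
  ring

lemma sizeCoeff_zero (q : ℝ) : sizeCoeff q 0 = 0 := by
  simp [sizeCoeff, coeffC_zero]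

lemma sizeCoeff_of_one_le {q : ℝ} (hq : 0 < q) {n : ℕ} (hn : 1 ≤ n) :
    sizeCoeff q n = 1 / √Real.pi * (Real.Gamma ((n : ℝ) - 1 / 2) / Real.Gamma ((n : ℝ) + 1)) *
      ((4 * q) ^ (n - 1) / (1 + q) ^ (2 * n - 1)) := by
  obtain ⟨m, rfl⟩ := Nat.exists_eq_add_of_le' hn
  have hG : Real.Gamma (((m + 1 : ℕ) : ℝ) + 1) ≠ 0 := (Real.Gamma_pos_of_pos (by positivity)).ne'
  have hpi : √Real.pi ≠ 0 := (Real.sqrt_pos.2 Real.pi_pos).ne'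
  have hq1 : 1 + q ≠ 0 := by positivity
  rw [sizeCoeff, if_neg (by omega), coeffC, div_pow, ← pow_mul,
    show 2 * (m + 1) - 1 = 2 * m + 1 by omega, show 2 * (m + 1) = 2 * m + 1 + 1 by ring,
    Nat.add_sub_cancel, pow_succ (1 + q) (2 * m + 1), pow_succ (4 * q) m]
  field_simp
  ring

/-- The coefficients of `√((1 - X z) (1 - Y z))`. -/
noncomputable def sqrtProdCoeff (q : ℝ) (n : ℕ) : ℝ :=
  ∑ k ∈ Finset.range (n + 1), coeffC k * coeffC (n - k) * coeffX q ^ k * coeffY q ^ (n - k)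

/-- The coefficients of `endGenFun q`. -/
noncomputable def endCoeff (q : ℝ) (n : ℕ) : ℝ :=
  1 / (2 * q * (1 + q)) * ((if n = 0 then 1 + q + q ^ 2 else 0) + (if n = 1 then q else 0) -
    (1 + q + q ^ 2) * sqrtProdCoeff q n)

lemma sqrtProdCoeff_zero (q : ℝ) : sqrtProdCoeff q 0 = 1 := by
  simp [sqrtProdCoeff, coeffC_zero]

/-- The extreme terms `k = 0` and `k = n` of the Cauchy product contain `C_0 = -1`; the others form
`coeffZ`. -/
lemma sqrtProdCoeff_of_one_le (q : ℝ) {n : ℕ} (hn : 1 ≤ n) :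
    sqrtProdCoeff q n = coeffZ q n - coeffC n * (coeffX q ^ n + coeffY q ^ n) := by
  rw [sqrtProdCoeff, Finset.sum_range_succ, ← Nat.Ico_zero_eq_range,
    Finset.sum_eq_sum_Ico_succ_bot hn, coeffZ]
  simp [coeffC_zero]
  ring

lemma endCoeff_zero (q : ℝ) : endCoeff q 0 = 0 := by
  simp [endCoeff, sqrtProdCoeff_zero]

lemma endCoeff_one (q : ℝ) : endCoeff q 1 = 1 / (2 * q * (1 + q)) *
    (q + (1 + q + q ^ 2) * coeffC 1 * (coeffX q + coeffY q)) := by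
  rw [endCoeff, sqrtProdCoeff_of_one_le q le_rfl]
  simp only [one_ne_zero, if_false, if_true, coeffZ, Finset.Ico_self, Finset.sum_empty, pow_one]
  ring

lemma endCoeff_of_one_lt (q : ℝ) {n : ℕ} (hn : 1 < n) :
    endCoeff q n = (1 + q + q ^ 2) / (2 * q * (1 + q)) *
      (coeffC n * (coeffX q ^ n + coeffY q ^ n) - coeffZ q n) := by
  rw [endCoeff, sqrtProdCoeff_of_one_le q hn.le, if_neg (by omega), if_neg (by omega)]
  ring

lemma coeffX_mem {q : ℝ} (hq : 0 < q) : coeffX q ∈ Set.Icc (0 : ℝ) 1 := by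
  unfold coeffX
  refine ⟨by positivity, (div_le_one (by positivity)).2 ?_⟩
  have : 0 ≤ (1 + q) * (1 + √q) ^ 2 := by positivity
  linarith

lemma coeffY_mem {q : ℝ} (hq : 0 < q) : coeffY q ∈ Set.Icc (0 : ℝ) 1 := by
  unfold coeffY
  refine ⟨by positivity, (div_le_one (by positivity)).2 ?_⟩
  have : 0 ≤ (1 + q) * (1 - √q) ^ 2 := by positivity
  linarith

/-- This is where `X` and `Y` come from: they are the reciprocals of the roots in `z` of the
discriminant. Writing `q = s ^ 2` makes the identity rational. -/
lemma discriminant_eq {q : ℝ} (hq : 0 < q) (z : ℝ) :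
    (1 + q + q ^ 2 + q * z) ^ 2 - 4 * q * (1 + q) ^ 2 * z =
      (1 + q + q ^ 2) ^ 2 * ((1 - coeffX q * z) * (1 - coeffY q * z)) := by
  obtain ⟨s, hs, rfl⟩ : ∃ s : ℝ, 0 < s ∧ q = s ^ 2 :=
    ⟨√q, Real.sqrt_pos.2 hq, (Real.sq_sqrt hq.le).symm⟩
  have hX : s ^ 2 + (1 + s ^ 2) * (1 + s) ^ 2 ≠ 0 := by positivity
  have hY : s ^ 2 + (1 + s ^ 2) * (1 - s) ^ 2 ≠ 0 := by positivity
  rw [coeffX, coeffY, Real.sqrt_sq hs.le]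
  field_simp
  ring

lemma hasSum_sqrtProdCoeff {q : ℝ} (hq : 0 < q) {z : ℝ} (hz : |z| < 1) :
    HasSum (fun n => sqrtProdCoeff q n * z ^ n)
      (√(1 - coeffX q * z) * √(1 - coeffY q * z)) := by
  have hlt {x : ℝ} (hx : x ∈ Set.Icc (0 : ℝ) 1) : |x * z| < 1 := by
    rw [abs_mul, abs_of_nonneg hx.1]
    nlinarith [abs_nonneg z, hx.1, hx.2]
  have hX := hasSum_sqrt_one_sub (hlt (coeffX_mem hq))
  have hY := hasSum_sqrt_one_sub (hlt (coeffY_mem hq))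
  rw [← hX.tsum_eq, ← hY.tsum_eq,
    tsum_mul_tsum_eq_tsum_sum_range_of_summable_norm hX.summable.norm hY.summable.norm]
  have hs := (summable_norm_sum_mul_range_of_summable_norm hX.summable.norm
    hY.summable.norm).of_norm.hasSum
  convert! hs using 2 with n
  rw [sqrtProdCoeff, Finset.sum_mul]
  refine Finset.sum_congr rfl fun k hk => ?_
  rw [mul_pow, mul_pow, ← Nat.add_sub_of_le (Nat.lt_succ_iff.1 (Finset.mem_range.1 hk)), pow_add]
  simp only [Nat.add_sub_cancel_left]
  ring

lemma hasSum_endCoeff {q : ℝ} (hq : 0 < q) {z : ℝ} (hz : |z| < 1) :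
    HasSum (fun n => endCoeff q n * z ^ n) (endGenFun q z) := by
  have hX : 0 ≤ 1 - coeffX q * z := by
    nlinarith [(coeffX_mem hq).1, (coeffX_mem hq).2, (abs_lt.1 hz).2]
  have h := (((hasSum_ite_eq_mul_pow 0 (1 + q + q ^ 2) z).add (hasSum_ite_eq_mul_pow 1 q z)).sub
    ((hasSum_sqrtProdCoeff hq hz).mul_left (1 + q + q ^ 2))).mul_left (1 / (2 * q * (1 + q)))
  rw [← Real.sqrt_mul hX] at h
  rw [endGenFun, discriminant_eq hq, Real.sqrt_mul (by positivity), Real.sqrt_sq (by positivity)]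
  convert! h using 2 with n
  · rw [endCoeff]
    ring
  · ring

/-! ### Solving the branching equation for geometric offspring -/

section Offspring

variable {f : PMF ℕ} {q : ℝ}

lemma hasSum_offspring (f : PMF ℕ) {z : ℝ} (hz : z ∈ Set.Icc (0 : ℝ) 1) :
    HasSum (fun j => (f j).toReal * z ^ j) (genFun (fun j => (f j).toReal) z) := by
  refine Summable.hasSum (Summable.of_nonneg_of_le
    (fun j => mul_nonneg ENNReal.toReal_nonneg (pow_nonneg hz.1 j))
    (fun j => mul_le_of_le_one_right ENNReal.toReal_nonneg (pow_le_one₀ hz.1 hz.2))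
    (ENNReal.summable_toReal ?_))
  rw [f.tsum_coe]
  exact ENNReal.one_ne_top

lemma toReal_finalGenFun_mem (f : PMF ℕ) (A : Set ℕ) {z : ℝ} (hz : z ≤ 1) :
    (finalGenFun f.toMeasure A (ENNReal.ofReal z)).toReal ∈ Set.Icc (0 : ℝ) 1 :=
  ⟨ENNReal.toReal_nonneg, ENNReal.toReal_le_of_le_ofReal zero_le_one
    (by simpa using finalGenFun_le_one f.toMeasure A (ENNReal.ofReal_le_one.2 hz))⟩

lemma toReal_finalGenFun_univ (hq : 0 < q)
    (hf : ∀ z ∈ Set.Icc (0 : ℝ) 1, genFun (fun j => (f j).toReal) z = 1 / (1 + q * (1 - z)))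
    {z : ℝ} (hz : z ∈ Set.Ico (0 : ℝ) 1) :
    (finalGenFun f.toMeasure Set.univ (ENNReal.ofReal z)).toReal = sizeGenFun q z := by
  classical
  have hG := toReal_finalGenFun_mem f Set.univ hz.2.le
  have h := hasSum_finalGenFun f Set.univ ⟨hz.1, hz.2.le⟩
  generalize (finalGenFun f.toMeasure Set.univ (ENNReal.ofReal z)).toReal = x at hG h
  have h2 := (hasSum_offspring f hG).mul_left z
  rw [hf x hG] at h2
  have hx : x = z * (1 / (1 + q * (1 - x))) := by
    refine h.unique ?_
    convert! h2 using 2 with j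
    simp only [Set.mem_univ, if_true]
    ring
  have hpos : 0 < 1 + q * (1 - x) := by nlinarith [hG.2]
  rw [mul_one_div, eq_div_iff hpos.ne'] at hx
  -- The quadratic takes the value `z - 1 < 0` at `1`; this is why `z = 1` is excluded here.
  rw [eq_smaller_root (α := q) (β := 1 + q) (γ := z) hq hG.2 (by linarith [hz.2])
    (by linear_combination -hx), sizeGenFun]
  ring

lemma toReal_finalGenFun_zero (hq : 0 < q)
    (hf : ∀ z ∈ Set.Icc (0 : ℝ) 1, genFun (fun j => (f j).toReal) z = 1 / (1 + q * (1 - z)))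
    {z : ℝ} (hz : z ∈ Set.Ico (0 : ℝ) 1) :
    (finalGenFun f.toMeasure {0} (ENNReal.ofReal z)).toReal = endGenFun q z := by
  classical
  have hG := toReal_finalGenFun_mem f {0} hz.2.le
  have h := hasSum_finalGenFun f {0} ⟨hz.1, hz.2.le⟩
  generalize (finalGenFun f.toMeasure {0} (ENNReal.ofReal z)).toReal = x at hG h
  have h0 : (f 0).toReal = 1 / (1 + q) := by
    have h1 := hasSum_offspring f (z := 0) (by simp)
    rw [hf 0 (by simp)] at h1
    have h2 : HasSum (fun j => (f j).toReal * (0 : ℝ) ^ j) (f 0).toReal := by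
      convert! hasSum_ite_eq 0 (f 0).toReal using 2 with j
      split_ifs with hj <;> simp [hj]
    simpa using h2.unique h1
  -- Only the term `j = 0` carries the weight `z`, which changes `q(x)` by `(z - 1) * f 0`.
  have h2 := (hasSum_offspring f hG).add (hasSum_ite_eq 0 ((z - 1) / (1 + q)))
  rw [hf x hG] at h2
  have hx : x = 1 / (1 + q * (1 - x)) + (z - 1) / (1 + q) := by
    refine h.unique ?_
    convert! h2 using 2 with j
    by_cases hj : j = 0
    · subst hj
      simp [h0]
      ring
    · simp [hj]
  have hpos : 0 < 1 + q * (1 - x) := by nlinarith [hG.2]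
  field_simp at hx
  rw [eq_smaller_root (α := q * (1 + q)) (β := 1 + q + q ^ 2 + q * z) (γ := (1 + q) * z)
    (by positivity) hG.2 (by linarith [hz.2]) (by linear_combination -hx), endGenFun,
    show 4 * (q * (1 + q)) * ((1 + q) * z) = 4 * q * (1 + q) ^ 2 * z by ring]
  ring

/-- If the final generating function is `F` on `[0, 1)` and `F` has the expansion `b` at `0`, then
the final probabilities are `b` and the expansion holds on `[-1, 1]`. -/
lemma finalProb_eq_and_hasSum {A : Set ℕ} {F : ℝ → ℝ} {b : ℕ → ℝ} (hF : Continuous F)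
    (h : ∀ z ∈ Set.Ico (0 : ℝ) 1,
      (finalGenFun f.toMeasure A (ENNReal.ofReal z)).toReal = F z)
    (hb : ∀ z, |z| < 1 → HasSum (fun n => b n * z ^ n) (F z)) :
    finalProb f.toMeasure A = b ∧
      ∀ z ∈ Set.Icc (-1 : ℝ) 1, HasSum (fun n => finalProb f.toMeasure A n * z ^ n) (F z) := by
  have heq : finalProb f.toMeasure A = b := by
    refine coeff_eq_of_hasSum (F := F) (fun z hz => ?_)
      fun z hz => hb z (by rw [abs_of_nonneg hz.1]; exact hz.2)
    rw [← h z hz]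
    exact hasSum_finalProb f.toMeasure A ⟨hz.1, hz.2.le⟩
  refine ⟨heq, fun z hz => hasSum_of_continuousOn_Icc (finalProb_nonneg _ A) ?_
    hF.continuousOn hz⟩
  rwa [heq]

end Offspring

end EvolvingTree

/-! ### Assembly of the two limit laws -/

theorem mainTheorem8 {Ω : Type*} [MeasurableSpace Ω] (P : Measure Ω) [IsProbabilityMeasure P]
    (Q q₁ : ℝ) (hQ : 0 < Q) (hq₁ : 0 < q₁)
    (f : PMF ℕ)
    (hf : ∀ z ∈ Set.Icc (0 : ℝ) 1,
      EvolvingTree.genFun (fun j => (f j).toReal) z = 1 / (1 + q₁ * (1 - z)))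
    (τ : Ω → List ℕ → ℝ) (ν : Ω → List ℕ → ℕ) (htree : EvolvingTree.IsRandomTree P Q f τ ν) :
    -- total number of nodes
    (∃ p : ℕ → ℝ,
      EvolvingTree.IsStationaryLaw P (fun t ω => EvolvingTree.treeSize (τ ω) (ν ω) t) p ∧
      p 0 = 0 ∧
      (∀ n : ℕ, 1 ≤ n →
        p n = 1 / √Real.pi * (Real.Gamma ((n : ℝ) - 1 / 2) / Real.Gamma ((n : ℝ) + 1)) *
          ((4 * q₁) ^ (n - 1) / (1 + q₁) ^ (2 * n - 1))) ∧
      (∀ z ∈ Set.Icc (-1 : ℝ) 1,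
        HasSum (fun n => p n * z ^ n)
          (1 / (2 * q₁) * (1 + q₁ - √((1 + q₁) ^ 2 - 4 * q₁ * z)))) ∧
      Tendsto (EvolvingTree.genFun p) (𝓝[<] 1) (𝓝 (if q₁ ≤ 1 then 1 else 1 / q₁)) ∧
      HasSum p (if q₁ ≤ 1 then 1 else 1 / q₁)) ∧
    -- number of end-nodes
    (∃ p₀ : ℕ → ℝ,
      EvolvingTree.IsStationaryLaw P (fun t ω => EvolvingTree.numEndNodes (τ ω) (ν ω) t) p₀ ∧
      p₀ 0 = 0 ∧
      p₀ 1 = 1 / (2 * q₁ * (1 + q₁)) *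
        (q₁ + (1 + q₁ + q₁ ^ 2) * EvolvingTree.coeffC 1 *
          (EvolvingTree.coeffX q₁ + EvolvingTree.coeffY q₁)) ∧
      (∀ n : ℕ, 1 < n →
        p₀ n = (1 + q₁ + q₁ ^ 2) / (2 * q₁ * (1 + q₁)) *
          (EvolvingTree.coeffC n * (EvolvingTree.coeffX q₁ ^ n + EvolvingTree.coeffY q₁ ^ n) -
            EvolvingTree.coeffZ q₁ n)) ∧
      (∀ z ∈ Set.Icc (-1 : ℝ) 1,
        HasSum (fun n => p₀ n * z ^ n)
          (1 / (2 * q₁ * (1 + q₁)) * (1 + q₁ + q₁ ^ 2 + q₁ * z -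
            √((1 + q₁ + q₁ ^ 2 + q₁ * z) ^ 2 - 4 * q₁ * (1 + q₁) ^ 2 * z)))) ∧
      HasSum p₀ (if q₁ ≤ 1 then 1 else 1 / q₁)) := by
  obtain ⟨hp, hps⟩ := EvolvingTree.finalProb_eq_and_hasSum
    (EvolvingTree.continuous_sizeGenFun q₁) (A := Set.univ)
    (fun z hz => EvolvingTree.toReal_finalGenFun_univ hq₁ hf hz)
    (fun z hz => EvolvingTree.hasSum_sizeCoeff hq₁ hz)
  obtain ⟨hp₀, hps₀⟩ := EvolvingTree.finalProb_eq_and_hasSum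
    (EvolvingTree.continuous_endGenFun q₁) (A := {0})
    (fun z hz => EvolvingTree.toReal_finalGenFun_zero hq₁ hf hz)
    (fun z hz => EvolvingTree.hasSum_endCoeff hq₁ hz)
  have hp1 : HasSum (EvolvingTree.finalProb f.toMeasure Set.univ)
      (if q₁ ≤ 1 then 1 else 1 / q₁) := by
    simpa [EvolvingTree.sizeGenFun_one hq₁] using hps 1 (by norm_num)
  have hp₀1 : HasSum (EvolvingTree.finalProb f.toMeasure {0})
      (if q₁ ≤ 1 then 1 else 1 / q₁) := by
    simpa [EvolvingTree.endGenFun_one hq₁] using hps₀ 1 (by norm_num)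
  refine ⟨⟨EvolvingTree.finalProb f.toMeasure Set.univ, ?_, ?_, fun n hn => ?_, hps, ?_, hp1⟩,
    ⟨EvolvingTree.finalProb f.toMeasure {0}, ?_, ?_, ?_, fun n hn => ?_, hps₀, hp₀1⟩⟩
  · exact htree.isStationaryLaw hQ EvolvingTree.measurable_treeSize
      (.of_forall fun ν τ n => EvolvingTree.eventually_treeSize_eq_iff τ ν n)
  · rw [hp, EvolvingTree.sizeCoeff_zero]
  · rw [hp, EvolvingTree.sizeCoeff_of_one_le hq₁ hn]
  · rw [← EvolvingTree.sizeGenFun_one hq₁]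
    refine (((EvolvingTree.continuous_sizeGenFun q₁).tendsto 1).mono_left
      nhdsWithin_le_nhds).congr' ?_
    filter_upwards [Ioo_mem_nhdsLT (show (-1 : ℝ) < 1 by norm_num)] with z hz
    exact (hps z (Set.Ioo_subset_Icc_self hz)).tsum_eq.symm
  · refine htree.isStationaryLaw hQ EvolvingTree.measurable_numEndNodes ?_
    -- The equal totals `hp₀1` and `hp1` exclude, up to a null set, infinite trees with finitely
    -- many childless nodes.
    filter_upwards [EvolvingTree.finalCount_ne_top_ae_of_hasSum f.toMeasure
      (Set.subset_univ {0}) hp₀1 hp1] with ν hν τ n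
    exact EvolvingTree.eventually_numEndNodes_eq_iff τ ν hν n
  · rw [hp₀, EvolvingTree.endCoeff_zero]
  · rw [hp₀, EvolvingTree.endCoeff_one]
  · rw [hp₀, EvolvingTree.endCoeff_of_one_lt q₁ hn]
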